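/- Let $(\Gamma,V)$ be a right-angled Coxeter system, i.e. $\Gamma=\langle V\mid (vw)^{m(v,w)}=1\ (v,w\in V)\rangle$ with $m(v,v)=1$ and $m(v,w)=m(w,v)\in\{2,\infty\}$ for $v\neq w$ (no relation if $m(v,w)=\infty$; $V$ may be infinite), and let $K(\Gamma,V)$ be the simplicial complex with vertex set $V$ whose simplices are the non-empty finite subsets of $V$ that generate finite subgroups of $\Gamma$. Let $L$ be an $n$-dimensional simplicial complex ($n\ge 0$) with $N$ simplices in total (the empty set is not counted as a simplex), such that every simplex of $L$ is a face of an $n$-simplex of $L$ and $|L|-|L^{n-2}|$ is connected, where $|\cdot|$ denotes geometric realisation and $L^{n-2}$ is the $(n-2)$-skeleton of $L$ (empty if $n\le 1$). Suppose that $K(\Gamma,V)$ is isomorphic to the barycentric subdivision of $L$, whose vertices are the simplices of $L$ and whose simplices are the non-empty finite chains of simplices of $L$ under inclusion. Then $\Gamma$ has a torsion-free normal subgroup $\Gamma_1$ of index $2^{n+1}$ which is generated by $N-n-1$ elements. $\Gamma$ has no torsion-free subgroup of index less than $2^{n+1}$, and every normal subgroup of $\Gamma$ of index $2^{n+1}$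 (torsion-free or not) requires at least $N-n-1$ generators. (If $L$ is infinite, $N$ is a cardinal number and $N-n-1$ means $N$.) -/

import Mathlib

universe u v w

namespace AbstractSimplicialComplex

variable {α β ι : Type*}

/-- `L` is `n`-dimensional: it has an `n`-simplex (a face with `n + 1` vertices), and no simplex of
larger dimension. -/
def HasDimension (L : AbstractSimplicialComplex ι) (n : ℕ) : Prop :=
  (∀ s ∈ L.faces, s.card ≤ n + 1) ∧ ∃ s ∈ L.faces, s.card = n + 1

/-- Every simplex of `L` is a face of an `n`-simplex of `L`. -/
def EveryFaceInSimplex (L : AbstractSimplicialComplex ι) (n : ℕ) : Prop :=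
  ∀ s ∈ L.faces, ∃ t ∈ L.faces, s ⊆ t ∧ t.card = n + 1

/-- The `k`-skeleton of `L`: the simplices of dimension at most `k`. The dimension of a simplex is
the number of its vertices minus one, so the skeleton is empty when `k < 0`. -/
def skeleton (L : AbstractSimplicialComplex ι) (k : ℤ) : PreAbstractSimplicialComplex ι where
  faces := {s | s ∈ L.faces ∧ (s.card : ℤ) - 1 ≤ k}
  isRelLowerSet_faces := by
    intro s hs
    refine ⟨(L.isRelLowerSet_faces hs.1).1, fun t hts ht => ?_⟩
    have hts' : t ⊆ s := hts
    have h1 := Finset.card_le_card hts'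
    have h2 := hs.2
    exact ⟨(L.isRelLowerSet_faces hs.1).2 hts ht, by omega⟩

/-- The points of the geometric realisation `|L|`, in barycentric coordinates. -/
@[ext]
structure Realization (L : AbstractSimplicialComplex ι) where
  /-- the barycentric coordinates of the point -/
  coord : ι →₀ ℝ
  nonneg : ∀ i, 0 ≤ coord i
  sum_eq_one : ∑ i ∈ coord.support, coord i = 1
  support_mem : coord.support ∈ L.faces

/-- The closed simplex `|s|` in `|L|`. -/
def closedSimplex (L : AbstractSimplicialComplex ι) (s : Finset ι) : Set L.Realization :=
  {p | p.coord.support ⊆ s}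

/-- The Euclidean topology on the closed simplex `|s|`, induced by the barycentric coordinates
(those outside the finite set `s` vanish on `|s|`). -/
@[reducible] def closedSimplexTopology (L : AbstractSimplicialComplex ι) (s : Finset ι) :
    TopologicalSpace (L.closedSimplex s) :=
  TopologicalSpace.induced (fun p i => p.1.coord i) (Pi.topologicalSpace : TopologicalSpace (ι → ℝ))

/-- The usual (weak) topology on `|L|`: a set is open if and only if its intersection with each
closed simplex of `L` is open in that simplex. -/
instance (L : AbstractSimplicialComplex ι) : TopologicalSpace L.Realization :=
  ⨆ s : L.faces, TopologicalSpace.coinduced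
    (Subtype.val : L.closedSimplex (s : Finset ι) → L.Realization)
    (L.closedSimplexTopology (s : Finset ι))

/-- The subset `|K|` of `|L|`, for a subcomplex `K` of `L`. -/
def polyhedron (L : AbstractSimplicialComplex ι) (K : PreAbstractSimplicialComplex ι) :
    Set L.Realization :=
  {p | p.coord.support ∈ K.faces}

/-- The barycentric subdivision of `L`: its vertices are the simplices of `L`, and its simplices
are the non-empty finite chains of simplices of `L` under inclusion. -/
def barycentricSubdivision (L : AbstractSimplicialComplex ι) :
    AbstractSimplicialComplex L.faces where
  faces := {c | c.Nonempty ∧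
    IsChain (fun s t : L.faces => (s : Finset ι) ⊆ (t : Finset ι)) (c : Set L.faces)}
  isRelLowerSet_faces := by
    intro c hc
    exact ⟨hc.1, fun d hdc hd => ⟨hd, hc.2.mono (by exact_mod_cast hdc)⟩⟩
  singleton_mem s := ⟨Finset.singleton_nonempty s, by simp⟩

/-- Two simplicial complexes are isomorphic: some bijection between their vertices takes the
simplices of one exactly to the simplices of the other. -/
def IsIsomorphic (K : AbstractSimplicialComplex α) (K' : AbstractSimplicialComplex β) : Prop :=
  ∃ e : α ≃ β, ∀ s : Finset α, s ∈ K.faces ↔ s.map e.toEmbedding ∈ K'.faces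

end AbstractSimplicialComplex

/-- A Coxeter matrix is right-angled if all its entries are `1`, `2` or `∞`
(in Mathlib `∞` is encoded by `0`). -/
def CoxeterMatrix.IsRightAngled {V : Type*} (M : CoxeterMatrix V) : Prop :=
  ∀ v w : V, M v w = 1 ∨ M v w = 2 ∨ M v w = 0

/-- The simplicial complex `K(Γ, V)` of a Coxeter system: its vertex set is the set `V` of
generators, and its simplices are the non-empty finite subsets of `V` that generate finite
subgroups of `Γ`. -/
def CoxeterSystem.complex {V Γ : Type*} [Group Γ] {M : CoxeterMatrix V} (cs : CoxeterSystem M Γ) :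
    AbstractSimplicialComplex V where
  faces := {s | s.Nonempty ∧ Finite (Subgroup.closure (cs.simple '' (s : Set V)))}
  isRelLowerSet_faces := by
    intro s hs
    refine ⟨hs.1, fun t hts ht => ⟨ht, ?_⟩⟩
    have hts' : (t : Set V) ⊆ (s : Set V) := by exact_mod_cast hts
    have hle := Subgroup.closure_mono (Set.image_mono (f := cs.simple) hts')
    have := hs.2
    exact Finite.of_injective _ (Subgroup.inclusion_injective hle)
  singleton_mem v := by
    refine ⟨Finset.singleton_nonempty v, ?_⟩
    have h : IsOfFinOrder (cs.simple v) :=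
      isOfFinOrder_iff_pow_eq_one.2 ⟨2, by norm_num, cs.simple_sq v⟩
    rw [Finset.coe_singleton, Set.image_singleton, ← Subgroup.zpowers_eq_closure]
    exact finite_zpowers.2 h

/-- A subgroup is torsion-free (in the sense of group theory) if its only element of finite order
is the identity. -/
def Subgroup.HasNoTorsion {Γ : Type*} [Group Γ] (H : Subgroup Γ) : Prop :=
  ∀ g ∈ H, IsOfFinOrder g → g = 1

/-! Colour each generator by the dimension of its simplex. Commuting distinct generators are
comparable simplices, so they have different colours, and counting generators of each colour modulo
two gives `φ : Γ → (ℤ/2)^(n+1)`. A maximal flag of `L` generates a finite subgroup that `φ` maps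
onto everything.

The subgroup Γ₁ is `φ.ker`. It is torsion-free: an element with even count in colour `i` that dies
when that colour is killed lies in a free group (`freeSplitting`), so colours can be killed one
after another without losing a torsion element. A finite subgroup meets a torsion-free one
trivially, so the flag subgroup gives the lower bound on the index.

For generators, start with one flag, whose subgroup meets the kernel trivially. Connectedness of
`|L| - |L^{n-2}|` makes any two flags linked by changes of one simplex at a time. Replacing `u` by
`v` costs the single kernel element `s u * s v`: the old flag subgroup normalises the cyclic group
it generates and maps onto `(ℤ/2)^(n+1)`, so no further conjugates are needed
(`sup_closure_inf_ker_le`). Thus one element for each generator outside the first flag suffices.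

Conversely, `Γ` maps onto an `𝔽₂`-vector space of dimension `N`, and a subgroup of index `2^(n+1)`
generates `Γ` after adjoining at most `n + 1` elements. -/

section SignedConj

/-! ### Signed conjugation on a free group -/

variable {G : Type*} [Group G]

/-- The endomorphism of the free group on `G` attached to a sign `ε` and `h : G`: it takes the
generator `g` to the `ε`-th power of the generator `h * g ^ ε * h⁻¹`. -/
def FreeGroup.signedConjHom (x : ℤˣ × G) : FreeGroup G →* FreeGroup G :=
  FreeGroup.lift fun g => FreeGroup.of (x.2 * g ^ (x.1 : ℤ) * x.2⁻¹) ^ (x.1 : ℤ)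

theorem FreeGroup.signedConjHom_of (x : ℤˣ × G) (g : G) :
    FreeGroup.signedConjHom x (FreeGroup.of g) =
      FreeGroup.of (x.2 * g ^ (x.1 : ℤ) * x.2⁻¹) ^ (x.1 : ℤ) := by
  simp [FreeGroup.signedConjHom]

theorem FreeGroup.signedConjHom_one :
    FreeGroup.signedConjHom (1 : ℤˣ × G) = MonoidHom.id (FreeGroup G) := by
  ext g
  simp [FreeGroup.signedConjHom_of]

theorem FreeGroup.signedConjHom_mul (x y : ℤˣ × G) :
    FreeGroup.signedConjHom (x * y) =
      (FreeGroup.signedConjHom x).comp (FreeGroup.signedConjHom y) := by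
  ext g
  simp only [FreeGroup.signedConjHom_of, MonoidHom.comp_apply, map_zpow, conj_zpow,
    Prod.fst_mul, Prod.snd_mul, Units.val_mul, ← zpow_mul, mul_inv_rev]
  simp only [mul_assoc, mul_comm (y.1 : ℤ)]

/-- The action of `ℤˣ × G` on the free group on `G` by `FreeGroup.signedConjHom`. -/
def FreeGroup.signedConj : ℤˣ × G →* MulAut (FreeGroup G) where
  toFun x := MonoidHom.toMulEquiv (FreeGroup.signedConjHom x) (FreeGroup.signedConjHom x⁻¹)
    (by rw [← FreeGroup.signedConjHom_mul, inv_mul_cancel, FreeGroup.signedConjHom_one])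
    (by rw [← FreeGroup.signedConjHom_mul, mul_inv_cancel, FreeGroup.signedConjHom_one])
  map_one' := by
    ext1 a
    exact DFunLike.congr_fun FreeGroup.signedConjHom_one a
  map_mul' x y := by
    ext1 a
    exact DFunLike.congr_fun (FreeGroup.signedConjHom_mul x y) a

theorem FreeGroup.signedConj_of (x : ℤˣ × G) (g : G) :
    FreeGroup.signedConj x (FreeGroup.of g) =
      FreeGroup.of (x.2 * g ^ (x.1 : ℤ) * x.2⁻¹) ^ (x.1 : ℤ) :=
  FreeGroup.signedConjHom_of x g

/-- The homomorphism that takes the free generator `g` to `g`, kills the signs and is the identity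
on `G`. -/
def FreeGroup.signedConjEval :
    FreeGroup G ⋊[FreeGroup.signedConj] (ℤˣ × G) →* G :=
  SemidirectProduct.lift (FreeGroup.lift id) (MonoidHom.snd ℤˣ G) fun x => by
    -- The sign disappears: `(h * g ^ ε * h⁻¹) ^ ε = h * g * h⁻¹` because `ε * ε = 1`.
    ext g
    simp only [MonoidHom.comp_apply, MulEquiv.coe_toMonoidHom, FreeGroup.signedConj_of, map_zpow,
      FreeGroup.lift_apply_of, id, MonoidHom.coe_snd, MulAut.conj_apply, conj_zpow, ← zpow_mul]
    simp

end SignedConj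

/-! ### Colourings of right-angled Coxeter groups and torsion -/

namespace CoxeterMatrix.IsRightAngled

variable {V : Type*} {M : CoxeterMatrix V}

theorem isLiftable (hM : M.IsRightAngled) {G : Type*} [Group G] (f : V → G)
    (hf : ∀ v, f v * f v = 1) (hcomm : ∀ v w, M v w = 2 → Commute (f v) (f w)) :
    M.IsLiftable f := by
  intro v w
  rcases hM v w with h | h | h
  · by_cases hvw : v = w
    · subst hvw
      simp [hf]
    · exact absurd h (M.off_diagonal v w hvw)
  · rw [h, (hcomm v w h).mul_pow, pow_two, pow_two, hf, hf, one_mul]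
  · rw [h, pow_zero]

end CoxeterMatrix.IsRightAngled

namespace CoxeterSystem

variable {V Γ : Type*} [Group Γ] {M : CoxeterMatrix V} (cs : CoxeterSystem M Γ)

theorem commute_simple {v w : V} (h : M v w = 2) : Commute (cs.simple v) (cs.simple w) := by
  have h1 := cs.simple_mul_simple_pow v w
  rw [h, pow_two] at h1
  have h2 := eq_inv_of_mul_eq_one_left h1
  rw [mul_inv_rev, cs.inv_simple, cs.inv_simple] at h2
  exact h2

theorem not_isOfFinOrder_simple_mul_simple (hM : M.IsRightAngled) {v w : V} (h : M v w = 0) :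
    ¬ IsOfFinOrder (cs.simple v * cs.simple w) := by
  classical
  have hvw : v ≠ w := by
    rintro rfl
    simp at h
  -- In the infinite dihedral group the product of these two reflections is the rotation `r 1`, of
  -- infinite order.
  let f : V → DihedralGroup 0 := fun x =>
    if x = v then DihedralGroup.sr 0 else if x = w then DihedralGroup.sr 1 else 1
  have hf : M.IsLiftable f := by
    refine hM.isLiftable f (fun x => ?_) fun x y hxy => ?_
    · dsimp only [f]
      split_ifs <;> simp
    · have hne : x ≠ y := by
        rintro rfl
        simp at hxy
      have h' := M.symmetric v w
      dsimp only [f]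
      split_ifs with h1 h2 h3 h4 h5 h6 <;> subst_vars <;> simp_all
  intro hfin
  have h1 := (cs.lift ⟨f, hf⟩).isOfFinOrder hfin
  rw [map_mul, cs.lift_apply_simple, cs.lift_apply_simple] at h1
  simp only [f, if_true, if_neg hvw.symm, DihedralGroup.sr_mul_sr, sub_zero] at h1
  rw [← orderOf_pos_iff, DihedralGroup.orderOf_r_one] at h1
  exact lt_irrefl _ h1

section Colouring

variable {C : Type*} [DecidableEq C] (hM : M.IsRightAngled) (c : V → C)

include hM in
theorem isLiftable_mulSingle :
    M.IsLiftable fun v => (Pi.mulSingle (c v) (-1) : C → ℤˣ) :=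
  hM.isLiftable _ (fun v => by rw [← Pi.mulSingle_mul]; simp) fun _ _ _ => Commute.all _ _

/-- The homomorphism counting, modulo two, the generators of each colour. -/
def colourSign : Γ →* (C → ℤˣ) :=
  cs.lift ⟨_, isLiftable_mulSingle hM c⟩

@[simp]
theorem colourSign_simple (v : V) :
    cs.colourSign hM c (cs.simple v) = Pi.mulSingle (c v) (-1) :=
  cs.lift_apply_simple _ v

include hM in
theorem isLiftable_killColour (i : C) :
    M.IsLiftable fun v => if c v = i then 1 else cs.simple v := by
  refine hM.isLiftable _ (fun v => ?_) fun v w h => ?_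
  · split_ifs <;> simp
  · have := cs.commute_simple h
    split_ifs <;> simp [this]

/-- The endomorphism that kills the generators of colour `i` and fixes the others. -/
def killColour (i : C) : Γ →* Γ :=
  cs.lift ⟨_, cs.isLiftable_killColour hM c i⟩

@[simp]
theorem killColour_simple (i : C) (v : V) :
    cs.killColour hM c i (cs.simple v) = if c v = i then 1 else cs.simple v :=
  cs.lift_apply_simple _ v

theorem colourSign_killColour (i j : C) (g : Γ) :
    cs.colourSign hM c (cs.killColour hM c i g) j =
      if j = i then 1 else cs.colourSign hM c g j := by
  induction g using cs.simple_induction with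
  | simple v =>
    rw [killColour_simple]
    split_ifs with h1 h2 h2
    · simp
    · rw [colourSign_simple, map_one, Pi.one_apply, Pi.mulSingle_eq_of_ne]
      rwa [h1]
    · rw [colourSign_simple, Pi.mulSingle_eq_of_ne]
      rw [h2]
      exact fun h => h1 h.symm
    · rfl
  | one => simp
  | mul g h hg hh =>
    rw [map_mul, map_mul, Pi.mul_apply, hg, hh, map_mul, Pi.mul_apply]
    split_ifs <;> simp

variable (hc : ∀ v w, M v w = 2 → c v ≠ c w)

include hM hc in
-- The sign `-1` takes `of g` to `(of g⁻¹)⁻¹`, so a simple `g`, being its own inverse, gives an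
-- involution. Conjugation by a commuting generator fixes `of (s v)`, and two distinct commuting
-- generators never both have colour `i`.
theorem isLiftable_freeSplitting (i : C) :
    M.IsLiftable fun v => if c v = i then
      (⟨FreeGroup.of (cs.simple v), (-1, 1)⟩ : FreeGroup Γ ⋊[FreeGroup.signedConj] (ℤˣ × Γ))
      else SemidirectProduct.inr (1, cs.simple v) := by
  have key : ∀ v w, M v w = 2 → Commute
      (⟨FreeGroup.of (cs.simple v), (-1, 1)⟩ : FreeGroup Γ ⋊[FreeGroup.signedConj] (ℤˣ × Γ))
      (SemidirectProduct.inr (1, cs.simple w)) := by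
    intro v w h
    have h2 := (cs.commute_simple h).eq
    ext
    · simp [FreeGroup.signedConj_of, ← h2]
    · simp
    · simp
  refine hM.isLiftable _ (fun v => ?_) fun v w h => ?_
  · split_ifs
    · ext <;> simp [FreeGroup.signedConj_of]
    · rw [← map_mul, Prod.mk_mul_mk, one_mul, cs.simple_mul_simple_self]
      exact map_one _
  · split_ifs with h1 h2 h2
    · exact absurd (h1.trans h2.symm) (hc v w h)
    · exact key v w h
    · exact (key w v (M.symmetric v w ▸ h)).symm
    · refine Commute.map ?_ _
      exact Prod.ext rfl (cs.commute_simple h)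

/-- An embedding of the Coxeter group in an extension of `ℤˣ × Γ` by a free group, when commuting
distinct generators have different colours: the generators of colour `i` go to involutions which
lie in the free group up to sign. -/
def freeSplitting (i : C) : Γ →* FreeGroup Γ ⋊[FreeGroup.signedConj] (ℤˣ × Γ) :=
  cs.lift ⟨_, cs.isLiftable_freeSplitting hM c hc i⟩

theorem freeSplitting_simple (i : C) (v : V) :
    cs.freeSplitting hM c hc i (cs.simple v) = if c v = i then
      ⟨FreeGroup.of (cs.simple v), (-1, 1)⟩ else SemidirectProduct.inr (1, cs.simple v) :=
  cs.lift_apply_simple _ v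

/-- `signedConjEval` is a left inverse, as can be checked on generators. -/
theorem freeSplitting_injective (i : C) :
    Function.Injective (cs.freeSplitting hM c hc i) := by
  have h : FreeGroup.signedConjEval.comp (cs.freeSplitting hM c hc i) = MonoidHom.id Γ := by
    apply cs.ext_simple
    intro v
    rw [MonoidHom.comp_apply, freeSplitting_simple]
    split_ifs
    · simp [FreeGroup.signedConjEval, SemidirectProduct.lift]
    · simp [FreeGroup.signedConjEval]
  exact Function.LeftInverse.injective (g := FreeGroup.signedConjEval) (DFunLike.congr_fun h)

theorem freeSplitting_right (i : C) (g : Γ) :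
    (cs.freeSplitting hM c hc i g).right = (cs.colourSign hM c g i, cs.killColour hM c i g) := by
  have h : SemidirectProduct.rightHom.comp (cs.freeSplitting hM c hc i) =
      ((Pi.evalMonoidHom _ i).comp (cs.colourSign hM c)).prod (cs.killColour hM c i) := by
    apply cs.ext_simple
    intro v
    rw [MonoidHom.comp_apply, freeSplitting_simple, MonoidHom.prod_apply, killColour_simple,
      MonoidHom.comp_apply, colourSign_simple, Pi.evalMonoidHom_apply]
    split_ifs with h
    · subst h
      simp
    · rw [Pi.mulSingle_eq_of_ne (Ne.symm h)]
      simp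
  exact DFunLike.congr_fun h g

include hc in
-- The two conditions say that the image of `g` under the splitting lies in the free group, which
-- has no torsion.
theorem eq_one_of_killColour_eq_one (i : C) {g : Γ} (hg : IsOfFinOrder g)
    (hsign : cs.colourSign hM c g i = 1) (hkill : cs.killColour hM c i g = 1) : g = 1 := by
  have hr : SemidirectProduct.rightHom (cs.freeSplitting hM c hc i g) = 1 := by
    rw [SemidirectProduct.rightHom_eq_right, freeSplitting_right, hsign, hkill]
    rfl
  rw [← MonoidHom.mem_ker, ← SemidirectProduct.range_inl_eq_ker_rightHom] at hr
  obtain ⟨f, hf⟩ := hr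
  have hfin : IsOfFinOrder (cs.freeSplitting hM c hc i g) := MonoidHom.isOfFinOrder _ hg
  rw [← hf, SemidirectProduct.inl_injective.isOfFinOrder_iff] at hfin
  rw [hfin.eq_one', map_one] at hf
  exact cs.freeSplitting_injective hM c hc i (hf.symm.trans (map_one _).symm)

include hc in
-- `F` kills the listed colours in turn. Killing a colour preserves finite order and trivial signs,
-- so the single-colour case applies at each stage.
theorem exists_hom_of_list (l : List C) :
    ∃ F : Γ →* Γ, (∀ v, c v ∈ l → F (cs.simple v) = 1) ∧
      ∀ g, IsOfFinOrder g → cs.colourSign hM c g = 1 → F g = 1 → g = 1 := by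
  induction l with
  | nil => exact ⟨MonoidHom.id Γ, by simp, fun g _ _ h => h⟩
  | cons i l ih =>
    obtain ⟨F, hF, hF'⟩ := ih
    refine ⟨F.comp (cs.killColour hM c i), fun v hv => ?_, fun g hg hs h => ?_⟩
    · rw [MonoidHom.comp_apply, killColour_simple]
      split_ifs with h
      · exact map_one F
      · exact hF v ((List.mem_cons.1 hv).resolve_left h)
    · refine cs.eq_one_of_killColour_eq_one hM c hc i hg (by rw [hs]; rfl) ?_
      refine hF' _ (MonoidHom.isOfFinOrder _ hg) ?_ h
      funext j
      rw [colourSign_killColour, hs]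
      simp

include hc in
theorem ker_colourSign_hasNoTorsion [Finite C] : (cs.colourSign hM c).ker.HasNoTorsion := by
  intro g hg hfin
  have := Fintype.ofFinite C
  obtain ⟨F, hF, hF'⟩ := cs.exists_hom_of_list hM c hc Finset.univ.toList
  refine hF' g hfin hg ?_
  have : F = 1 := cs.ext_simple fun v => hF v (by simp)
  rw [this, MonoidHom.one_apply]

end Colouring

end CoxeterSystem

/-! ### Generating a kernel along a gallery -/

namespace Subgroup

variable {G Q V : Type*} [Group G] [Group Q]

theorem mem_normalizer_zpowers_of_sq {w z : G} (hw : w * w = 1)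
    (h : w * z * w⁻¹ = z ∨ w * z * w⁻¹ = z⁻¹) : w ∈ normalizer (zpowers z : Set G) := by
  have key : ∀ x ∈ zpowers z, w * x * w⁻¹ ∈ zpowers z := by
    rintro _ ⟨k, rfl⟩
    rw [← conj_zpow]
    refine zpow_mem ?_ k
    rcases h with h | h <;> rw [h]
    · exact mem_zpowers z
    · exact inv_mem (mem_zpowers z)
  rw [mem_normalizer_iff]
  refine fun x => ⟨key x, fun hx => ?_⟩
  have := key _ hx
  have hw' : w⁻¹ = w := inv_eq_of_mul_eq_one_left hw
  have e : w * (w * x * w⁻¹) * w⁻¹ = x := by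
    rw [hw']
    calc w * (w * x * w) * w = (w * w) * x * (w * w) := by group
      _ = x := by rw [hw, one_mul, mul_one]
  rwa [e] at this

/-- Since `E` maps onto `Q`, each `b ∈ B` is `a * f` with `a ∈ B ⊓ φ.ker ≤ closure Z` and `f ∈ E`
normalising `zpowers z`. Hence `B` normalises `closure Z`, the join is the product `B * closure Z`,
and as `Z` lies in the kernel only `B ⊓ φ.ker` has to be absorbed. -/
theorem sup_closure_inf_ker_le (φ : G →* Q) {B : Subgroup G} {Z : Set G}
    (hBZ : B ⊓ φ.ker ≤ closure Z) (hZ : Z ⊆ φ.ker)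
    (h : ∀ z ∈ Z, ∃ E ≤ B, E.map φ = ⊤ ∧ E ≤ normalizer (zpowers z : Set G)) :
    (B ⊔ closure Z) ⊓ φ.ker ≤ closure Z := by
  have hB : B ≤ normalizer (closure Z : Set G) := by
    rw [le_normalizer_closure_iff]
    intro b hb z hz
    obtain ⟨E, hEB, hE, hEz⟩ := h z hz
    obtain ⟨f, hf, hfb⟩ : φ b ∈ E.map φ := hE ▸ mem_top _
    have ha : b * f⁻¹ ∈ closure Z := by
      refine hBZ ⟨B.mul_mem hb (B.inv_mem (hEB hf)), ?_⟩
      change b * f⁻¹ ∈ φ.ker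
      rw [MonoidHom.mem_ker, map_mul, map_inv, hfb, mul_inv_cancel]
    have hc : f * z * f⁻¹ ∈ closure Z := by
      have := (mem_normalizer_iff.1 (hEz hf) z).1 (mem_zpowers z)
      exact (zpowers_le.2 (subset_closure hz)) this
    have e : b * z * b⁻¹ = (b * f⁻¹) * (f * z * f⁻¹) * (b * f⁻¹)⁻¹ := by group
    rw [e]
    exact mul_mem (mul_mem ha hc) (inv_mem ha)
  intro x hx
  obtain ⟨hx, hxk⟩ := mem_inf.1 hx
  rw [← SetLike.mem_coe, coe_mul_of_left_le_normalizer_right _ _ hB] at hx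
  obtain ⟨b, hb, a, ha, rfl⟩ := hx
  refine mul_mem (hBZ ⟨hb, ?_⟩) ha
  have hak : a ∈ φ.ker := (closure_le _).2 hZ ha
  simpa [MonoidHom.mem_ker, MonoidHom.mem_ker.1 hak] using hxk

/-- The sets of generators obtained from `σ` by repeatedly adding every generator that can
take the place of an element of some member of `𝓕` that has been reached already. -/
def galleryLevel (s : V → G) (φ : G →* Q) (𝓕 : Set (Set V)) (σ : Set V) : ℕ → Set V
  | 0 => σ
  | k + 1 => galleryLevel s φ 𝓕 σ k ∪ {v | ∃ F ∈ 𝓕, F ⊆ galleryLevel s φ 𝓕 σ k ∧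
      ∃ u ∈ F, φ (s u) = φ (s v) ∧ ∀ w ∈ F, w ≠ u → Commute (s v) (s w)}

theorem galleryLevel_mono (s : V → G) (φ : G →* Q) (𝓕 : Set (Set V)) (σ : Set V) :
    Monotone (galleryLevel s φ 𝓕 σ) :=
  monotone_nat_of_le_succ fun _ _ hx => Or.inl hx

/-- Taking `u` from the first level that contains `v` makes one `u` serve all later levels, so the
kernel element attached to `v` does not depend on the level. -/
theorem exists_exchange_of_mem_galleryLevel {s : V → G} {φ : G →* Q} {𝓕 : Set (Set V)}
    {σ : Set V} {v : V} (hv : v ∉ σ) (h : ∃ k, v ∈ galleryLevel s φ 𝓕 σ k) :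
    ∃ u, φ (s u) = φ (s v) ∧ ∀ k, v ∈ galleryLevel s φ 𝓕 σ (k + 1) →
      ∃ F ∈ 𝓕, F ⊆ galleryLevel s φ 𝓕 σ k ∧ u ∈ F ∧
        ∀ w ∈ F, w ≠ u → Commute (s v) (s w) := by
  classical
  have hspec := Nat.find_spec h
  have hmin := fun m => Nat.find_min' h (m := m)
  generalize Nat.find h = m at hspec hmin
  match m, hspec, hmin with
  | 0, hspec, _ => exact absurd hspec hv
  | j + 1, Or.inl hspec, hmin => exact absurd (hmin j hspec) (by omega)
  | j + 1, Or.inr ⟨F, hF, hFj, u, hu, hφ, hcomm⟩, hmin =>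
    refine ⟨u, hφ, fun k hk => ⟨F, hF, hFj.trans ?_, hu, hcomm⟩⟩
    exact galleryLevel_mono _ _ _ _ (by have := hmin _ hk; omega)

/-- If all of a set of involutions generating a group is reached from `σ` by exchanges, then the
kernel of `φ` is generated by one element for each generator outside `σ`. -/
theorem exists_closure_image_compl_eq_ker (s : V → G) (φ : G →* Q) (𝓕 : Set (Set V)) (σ : Set V)
    (hs : ∀ v, s v * s v = 1) (hgen : closure (Set.range s) = ⊤)
    (hcomm : ∀ F ∈ 𝓕, ∀ u ∈ F, ∀ w ∈ F, Commute (s u) (s w))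
    (htop : ∀ F ∈ 𝓕, (closure (s '' F)).map φ = ⊤)
    (hσ : closure (s '' σ) ⊓ φ.ker = ⊥)
    (hreach : ∀ v, ∃ k, v ∈ galleryLevel s φ 𝓕 σ k) :
    ∃ g : V → G, closure (g '' σᶜ) = φ.ker := by
  classical
  have hinv : ∀ v, (s v)⁻¹ = s v := fun v => inv_eq_of_mul_eq_one_left (hs v)
  have hex : ∀ v, ∃ u, v ∉ σ → φ (s u) = φ (s v) ∧ ∀ k, v ∈ galleryLevel s φ 𝓕 σ (k + 1) →
      ∃ F ∈ 𝓕, F ⊆ galleryLevel s φ 𝓕 σ k ∧ u ∈ F ∧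
        ∀ w ∈ F, w ≠ u → Commute (s v) (s w) := by
    intro v
    by_cases hv : v ∈ σ
    · exact ⟨v, fun h => absurd hv h⟩
    · obtain ⟨u, hu⟩ := exists_exchange_of_mem_galleryLevel hv (hreach v)
      exact ⟨u, fun _ => hu⟩
  choose p hp using hex
  have hker : ∀ v ∉ σ, s (p v) * s v ∈ φ.ker := by
    intro v hv
    rw [MonoidHom.mem_ker, map_mul, (hp v hv).1, ← map_mul, hs, map_one]
  have hlevel : ∀ k, closure (s '' galleryLevel s φ 𝓕 σ k) ⊓ φ.ker ≤
      closure ((fun v => s (p v) * s v) '' (galleryLevel s φ 𝓕 σ k \ σ)) := by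
    intro k
    induction k with
    | zero => exact hσ.le.trans bot_le
    | succ k ih =>
      have hmono : galleryLevel s φ 𝓕 σ k ⊆ galleryLevel s φ 𝓕 σ (k + 1) :=
        galleryLevel_mono _ _ _ _ k.le_succ
      refine le_trans (inf_le_inf_right _ ?_)
        (sup_closure_inf_ker_le φ (B := closure (s '' galleryLevel s φ 𝓕 σ k)) ?_ ?_ ?_)
      · rw [closure_le]
        rintro _ ⟨v, hv, rfl⟩
        by_cases hvσ : v ∈ σ
        · exact mem_sup_left (subset_closure
            ⟨v, galleryLevel_mono s φ 𝓕 σ (Nat.zero_le k) hvσ, rfl⟩)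
        · obtain ⟨F, -, hFk, hu, -⟩ := (hp v hvσ).2 k hv
          have e : s v = s (p v) * (s (p v) * s v) := by rw [← mul_assoc, hs, one_mul]
          rw [e]
          exact mul_mem_sup (subset_closure ⟨_, hFk hu, rfl⟩) (subset_closure ⟨v, ⟨hv, hvσ⟩, rfl⟩)
      · exact ih.trans (closure_mono (Set.image_mono (Set.sdiff_subset_sdiff_left hmono)))
      · rintro _ ⟨v, hv, rfl⟩
        exact hker v hv.2
      · rintro _ ⟨v, ⟨hv, hvσ⟩, rfl⟩
        obtain ⟨F, hF, hFk, hu, hvF⟩ := (hp v hvσ).2 k hv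
        refine ⟨closure (s '' F), closure_mono (Set.image_mono hFk), htop F hF, ?_⟩
        rw [closure_le]
        rintro _ ⟨w, hw, rfl⟩
        refine mem_normalizer_zpowers_of_sq (hs w) ?_
        -- The exchanged generator `p v` inverts `s (p v) * s v`; the rest of `F` commutes with both
        -- factors.
        by_cases hwu : w = p v
        · right
          subst hwu
          rw [← mul_assoc, hs, one_mul, mul_inv_rev, hinv, hinv]
        · left
          have hc : Commute (s w) (s (p v) * s v) :=
            (hcomm F hF w hw _ hu).mul_right (hvF w hw hwu).symm
          rw [hc.eq, mul_inv_cancel_right]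
  refine ⟨fun v => s (p v) * s v, le_antisymm ?_ fun x hx => ?_⟩
  · rw [closure_le]
    rintro _ ⟨v, hv, rfl⟩
    exact hker v hv
  · have hx' : ∃ k, x ∈ closure (s '' galleryLevel s φ 𝓕 σ k) := by
      have hdir : Directed (· ≤ ·) fun k => closure (s '' galleryLevel s φ 𝓕 σ k) :=
        Monotone.directed_le fun i j hij =>
          closure_mono (Set.image_mono (galleryLevel_mono s φ 𝓕 σ hij))
      rw [← mem_iSup_of_directed hdir]
      refine (?_ : (⊤ : Subgroup G) ≤ _) (mem_top x)
      rw [← hgen, closure_le]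
      rintro _ ⟨v, rfl⟩
      obtain ⟨k, hk⟩ := hreach v
      exact mem_iSup_of_mem k (subset_closure ⟨v, hk, rfl⟩)
    obtain ⟨k, hk⟩ := hx'
    exact closure_mono (Set.image_mono fun v hv => hv.2) (hlevel k ⟨hk, hx⟩)

end Subgroup

/-! ### Bounds on index and on number of generators -/

theorem Subgroup.exists_finset_closure_union_eq_top {G : Type*} [Group G] (m : ℕ) (H : Subgroup G)
    (h0 : H.index ≠ 0) (hH : H.index ≤ 2 ^ m) :
    ∃ T : Finset G, T.card ≤ m ∧ closure ((H : Set G) ∪ T) = ⊤ := by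
  classical
  induction m generalizing H with
  | zero =>
    refine ⟨∅, le_rfl, ?_⟩
    have : H = ⊤ := index_eq_one.1 (by simp at hH; omega)
    simp [this]
  | succ m ih =>
    by_cases htop : H = ⊤
    · exact ⟨∅, by simp, by simp [htop]⟩
    obtain ⟨g, hg⟩ : ∃ g, g ∉ H := by
      by_contra! h
      exact htop ((eq_top_iff' H).2 h)
    have hle : H ≤ H ⊔ zpowers g := le_sup_left
    have hmul := relIndex_mul_index hle
    have hne : H.relIndex (H ⊔ zpowers g) ≠ 1 := by
      rw [Ne, relIndex_eq_one]
      exact fun h => hg (h (mem_sup_right (mem_zpowers g)))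
    have h1 : (H ⊔ zpowers g).index ≠ 0 := by
      rintro h
      rw [h, mul_zero] at hmul
      exact h0 hmul.symm
    have h2 : H.relIndex (H ⊔ zpowers g) ≠ 0 := by
      rintro h
      rw [h, zero_mul] at hmul
      exact h0 hmul.symm
    -- Adjoining an element outside `H` at least halves the index.
    obtain ⟨T, hT, hTtop⟩ := ih (H ⊔ zpowers g) h1 (by
      have : 2 * (H ⊔ zpowers g).index ≤ H.index := by
        rw [← hmul]
        exact Nat.mul_le_mul_right _ (by omega)
      rw [pow_succ] at hH
      omega)
    refine ⟨insert g T, (Finset.card_insert_le _ _).trans (by omega), ?_⟩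
    rw [eq_top_iff, ← hTtop, closure_le]
    rintro x (hx | hx)
    · refine (sup_le ?_ ?_ : H ⊔ zpowers g ≤ _) hx
      · exact fun y hy => subset_closure (Or.inl hy)
      · rw [zpowers_le]
        exact subset_closure (Or.inr (by simp))
    · exact subset_closure (Or.inr (by simp [Finset.mem_coe.1 hx]))

/-- A subgroup of `C → ℤˣ`, `C` finite, containing the standard basis is everything. -/
theorem Subgroup.eq_top_of_mulSingle_neg_one_mem {C : Type*} [Finite C] [DecidableEq C]
    (H : Subgroup (C → ℤˣ)) (h : ∀ i, Pi.mulSingle i (-1) ∈ H) : H = ⊤ := by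
  rw [eq_top_iff']
  intro x
  refine pi_mem_of_mulSingle_mem x fun i => ?_
  rcases Int.units_eq_one_or (x i) with hx | hx <;> rw [hx]
  · rw [Pi.mulSingle_one]
    exact one_mem H
  · exact h i

/-- A finite subgroup meets a torsion-free subgroup trivially, so its order is at most the
index. -/
theorem Subgroup.HasNoTorsion.card_le_index {G : Type*} [Group G] {H : Subgroup G}
    (hH : H.HasNoTorsion) (h0 : H.index ≠ 0) (F : Subgroup G) [Finite F] :
    Nat.card F ≤ H.index := by
  have : Finite (G ⧸ H) := Nat.finite_of_card_ne_zero h0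
  refine Nat.card_le_card_of_injective (fun x : F => (QuotientGroup.mk (x : G) : G ⧸ H)) ?_
  intro x y hxy
  have h1 : (x : G)⁻¹ * y ∈ H := QuotientGroup.eq.1 hxy
  have h2 : IsOfFinOrder ((x : G)⁻¹ * y) :=
    F.subtype.isOfFinOrder (isOfFinOrder_of_finite (x⁻¹ * y))
  exact Subtype.ext (inv_mul_eq_one.1 (hH _ h1 h2))

namespace CoxeterSystem

variable {V : Type v} {Γ : Type w} [Group Γ] {M : CoxeterMatrix V} (cs : CoxeterSystem M Γ)

include cs in
/-- A generating set of a right-angled Coxeter group has at least as many elements as the set of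
simple generators. -/
theorem lift_mk_le_of_closure_eq_top (hM : M.IsRightAngled) {X : Type u} (e : V ≃ X) {S : Set Γ}
    (hS : Subgroup.closure S = ⊤) :
    Cardinal.lift.{w} (Cardinal.mk X) ≤ Cardinal.lift.{u} (Cardinal.mk S) := by
  let f : V → Multiplicative (X →₀ ZMod 2) := fun v =>
    Multiplicative.ofAdd (Finsupp.single (e v) 1)
  have hf : M.IsLiftable f := hM.isLiftable f
    (fun v => by
      rw [← ofAdd_add, ← Finsupp.single_add, CharTwo.add_self_eq_zero, Finsupp.single_zero,
        ofAdd_zero])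
    fun _ _ _ => Commute.all _ _
  let χ : Γ →* Multiplicative (X →₀ ZMod 2) := cs.lift ⟨f, hf⟩
  let ψ : Γ → (X →₀ ZMod 2) := fun g => Multiplicative.toAdd (χ g)
  -- Generators of `Γ` map to a spanning set of a space with basis indexed by `X`, so there are at
  -- least as many of them as the rank.
  have hspan : Submodule.span (ZMod 2) (ψ '' S) = ⊤ := by
    have hmem : ∀ g : Γ, ψ g ∈ Submodule.span (ZMod 2) (ψ '' S) := by
      intro g
      have hg : g ∈ Subgroup.closure S := hS ▸ Subgroup.mem_top g
      induction hg using Subgroup.closure_induction with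
      | mem x hx => exact Submodule.subset_span ⟨x, hx, rfl⟩
      | one => simp [ψ]
      | mul x y _ _ hx hy =>
        simpa only [ψ, map_mul, toAdd_mul] using Submodule.add_mem _ hx hy
      | inv x _ hx => simpa only [ψ, map_inv, toAdd_inv] using Submodule.neg_mem _ hx
    rw [eq_top_iff, ← (Finsupp.basisSingleOne (R := ZMod 2) (ι := X)).span_eq, Submodule.span_le]
    rintro _ ⟨x, rfl⟩
    have := hmem (cs.simple (e.symm x))
    simpa [ψ, χ, f, cs.lift_apply_simple] using this
  have h1 := rank_span_le (R := ZMod 2) (ψ '' S)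
  rw [hspan, rank_top, rank_finsupp_self, Cardinal.lift_uzero] at h1
  calc Cardinal.lift.{w} (Cardinal.mk X) ≤ Cardinal.lift.{w} (Cardinal.mk (ψ '' S)) :=
        Cardinal.lift_le.2 h1
    _ ≤ Cardinal.lift.{u} (Cardinal.mk S) := Cardinal.mk_image_le_lift

include cs in
theorem lift_mk_le_add_of_index_le (hM : M.IsRightAngled) {X : Type u} (e : V ≃ X)
    {H : Subgroup Γ} {m : ℕ} (h0 : H.index ≠ 0) (hH : H.index ≤ 2 ^ m) {S : Set Γ}
    (hS : Subgroup.closure S = H) :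
    Cardinal.lift.{w} (Cardinal.mk X) ≤ Cardinal.lift.{u} (Cardinal.mk S) + m := by
  obtain ⟨T, hT, htop⟩ := H.exists_finset_closure_union_eq_top m h0 hH
  have hST : Subgroup.closure (S ∪ T) = ⊤ := by
    rw [← htop, Subgroup.closure_union, Subgroup.closure_union, hS, Subgroup.closure_eq]
  refine (cs.lift_mk_le_of_closure_eq_top hM e hST).trans ?_
  have h1 : Cardinal.mk (S ∪ T : Set Γ) ≤ Cardinal.mk S + m := by
    refine (Cardinal.mk_union_le _ _).trans (add_le_add_right ?_ _)
    rw [Finset.coe_sort_coe, Cardinal.mk_coe_finset]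
    exact_mod_cast hT
  calc Cardinal.lift.{u} (Cardinal.mk (S ∪ T : Set Γ)) ≤ Cardinal.lift.{u} (Cardinal.mk S + m) :=
        Cardinal.lift_le.2 h1
    _ = _ := by simp

open Pointwise in
theorem finite_closure_pair {v w : V} (h : M v w = 2) :
    Finite (Subgroup.closure {cs.simple v, cs.simple w}) := by
  have hfin : ∀ x, (Subgroup.zpowers (cs.simple x) : Set Γ).Finite := fun x =>
    finite_zpowers.2 (isOfFinOrder_iff_pow_eq_one.2 ⟨2, by norm_num, cs.simple_sq x⟩)
  have hn : Subgroup.zpowers (cs.simple v) ≤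
      Subgroup.normalizer (Subgroup.zpowers (cs.simple w) : Set Γ) := by
    rw [Subgroup.zpowers_le]
    refine Subgroup.mem_normalizer_zpowers_of_sq (cs.simple_mul_simple_self v) (Or.inl ?_)
    rw [(cs.commute_simple h).eq, mul_inv_cancel_right]
  have e : ((Subgroup.closure {cs.simple v, cs.simple w} : Subgroup Γ) : Set Γ) =
      (Subgroup.zpowers (cs.simple v) : Set Γ) * (Subgroup.zpowers (cs.simple w) : Set Γ) := by
    rw [← Subgroup.coe_mul_of_left_le_normalizer_right _ _ hn, Set.insert_eq,
      Subgroup.closure_union, ← Subgroup.zpowers_eq_closure, ← Subgroup.zpowers_eq_closure]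
  exact Set.Finite.to_subtype (e ▸ (hfin v).mul (hfin w))

theorem pair_mem_complex_iff [DecidableEq V] (hM : M.IsRightAngled) {v w : V} (hvw : v ≠ w) :
    {v, w} ∈ cs.complex.faces ↔ M v w = 2 := by
  have e : cs.simple '' (({v, w} : Finset V) : Set V) = {cs.simple v, cs.simple w} := by
    simp [Set.image_pair]
  constructor
  · rintro ⟨-, hfin⟩
    rw [e] at hfin
    rcases hM v w with h | h | h
    · exact absurd h (M.off_diagonal v w hvw)
    · exact h
    · refine absurd ?_ (cs.not_isOfFinOrder_simple_mul_simple hM h)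
      have hm : cs.simple v * cs.simple w ∈ Subgroup.closure {cs.simple v, cs.simple w} :=
        mul_mem (Subgroup.subset_closure (by simp)) (Subgroup.subset_closure (by simp))
      exact (Subgroup.subtype _).isOfFinOrder (isOfFinOrder_of_finite
        (⟨_, hm⟩ : Subgroup.closure {cs.simple v, cs.simple w}))
  · intro h
    refine ⟨⟨v, by simp⟩, ?_⟩
    rw [e]
    exact cs.finite_closure_pair h

end CoxeterSystem

/-! ### Connecting chambers and flags -/

namespace AbstractSimplicialComplex

variable {ι : Type*} (L : AbstractSimplicialComplex ι) (n : ℕ)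

/-- An `n`-simplex of `L`. -/
def IsChamber (s : Finset ι) : Prop := s ∈ L.faces ∧ s.card = n + 1

/-- Two `n`-simplices of `L` are adjacent if they share at least `n` vertices. -/
def ChamberAdj [DecidableEq ι] (s t : Finset ι) : Prop :=
  L.IsChamber n s ∧ L.IsChamber n t ∧ n ≤ (s ∩ t).card

theorem exists_realization_support_eq {s : Finset ι} (hs : s ∈ L.faces) :
    ∃ p : L.Realization, p.coord.support = s := by
  classical
  have hne : s.Nonempty := (L.isRelLowerSet_faces hs).1
  have hc : (0 : ℝ) < s.card := by exact_mod_cast hne.card_pos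
  let f : ι →₀ ℝ := Finsupp.indicator s fun _ _ => (s.card : ℝ)⁻¹
  have hf : ∀ i ∈ s, f i = (s.card : ℝ)⁻¹ := fun i hi => Finsupp.indicator_of_mem hi _
  have hf' : ∀ i ∉ s, f i = 0 := fun i hi => Finsupp.indicator_of_notMem hi _
  have hsupp : f.support = s := by
    ext i
    rw [Finsupp.mem_support_iff]
    by_cases hi : i ∈ s
    · simp [hf i hi, hi, hc.ne']
    · simp [hf' i hi, hi]
  refine ⟨⟨f, fun i => ?_, ?_, hsupp ▸ hs⟩, hsupp⟩
  · by_cases hi : i ∈ s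
    · rw [hf i hi]
      positivity
    · rw [hf' i hi]
  · rw [hsupp, Finset.sum_congr rfl hf, Finset.sum_const, nsmul_eq_mul, mul_inv_cancel₀ hc.ne']

/-- The points in the relative interiors of the simplices of dimension at least `n - 1` that lie
in a member of `P`. -/
def openPart (P : Set (Finset ι)) : Set L.Realization :=
  {p | n ≤ p.coord.support.card ∧ ∃ s ∈ P, p.coord.support ⊆ s}

variable {L n}

/-- If a closed simplex `s` meets the set, an `n`-simplex containing `s` shares at least `n`
vertices with a member of `P`, so it is in `P`. Then inside `s` the set is cut out by the open
condition that at least `n` coordinates are non-zero. -/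
theorem isOpen_openPart [DecidableEq ι] (hpure : L.EveryFaceInSimplex n) {P : Set (Finset ι)}
    (hP : ∀ s ∈ P, L.IsChamber n s) (hadj : ∀ s ∈ P, ∀ t, L.ChamberAdj n s t → t ∈ P) :
    IsOpen (L.openPart n P) := by
  have hU : IsOpen {x : ι → ℝ | ∃ T : Finset ι, T.card = n ∧ ∀ i ∈ T, x i ≠ 0} := by
    have : {x : ι → ℝ | ∃ T : Finset ι, T.card = n ∧ ∀ i ∈ T, x i ≠ 0} =
        ⋃ T : {T : Finset ι // T.card = n}, ⋂ i ∈ T.1, {x : ι → ℝ | x i ≠ 0} := by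
      ext x
      simp
    rw [this]
    refine isOpen_iUnion fun T => isOpen_biInter_finset fun i _ => ?_
    exact isOpen_ne_fun (continuous_apply i) continuous_const
  refine isOpen_iSup_iff.2 fun s => isOpen_coinduced.2 ?_
  by_cases hq : ∃ q : L.closedSimplex (s : Finset ι), q.1 ∈ L.openPart n P
  · obtain ⟨q, hqn, t, ht, hqt⟩ := hq
    obtain ⟨s', hs', hss', hcard⟩ := hpure s.1 s.2
    have hs'P : s' ∈ P := hadj t ht s' ⟨hP t ht, ⟨hs', hcard⟩,
      hqn.trans (Finset.card_le_card (Finset.subset_inter hqt (q.2.trans hss')))⟩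
    refine isOpen_induced_iff.2 ⟨_, hU, ?_⟩
    ext p
    constructor
    · rintro ⟨T, hT, hTp⟩
      have hTs : T ⊆ p.1.coord.support := fun i hi => Finsupp.mem_support_iff.2 (hTp i hi)
      exact ⟨hT ▸ Finset.card_le_card hTs, s', hs'P, p.2.trans hss'⟩
    · rintro ⟨hp, -⟩
      obtain ⟨T, hTp, hT⟩ := Finset.exists_subset_card_eq hp
      exact ⟨T, hT, fun i hi => Finsupp.mem_support_iff.1 (hTp hi)⟩
  · have : (Subtype.val : L.closedSimplex (s : Finset ι) → L.Realization) ⁻¹' L.openPart n P = ∅ :=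
      Set.eq_empty_iff_forall_notMem.2 fun q h => hq ⟨q, h⟩
    rw [this]
    exact @isOpen_empty _ (L.closedSimplexTopology s)

/-- The chambers reachable from `s` and the unreachable ones give two open sets covering `|L| -
|L^{n-2}|`. A common point has at least `n` support vertices, all shared by a chamber of each kind,
so these two chambers would be adjacent. -/
theorem reflTransGen_chamberAdj [DecidableEq ι] (hpure : L.EveryFaceInSimplex n)
    (hconn : IsConnected (Set.univ \ L.polyhedron (L.skeleton ((n : ℤ) - 2))))
    {s t : Finset ι} (hs : L.IsChamber n s) (ht : L.IsChamber n t) :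
    Relation.ReflTransGen (L.ChamberAdj n) s t := by
  by_contra hst
  let P : Set (Finset ι) := {r | L.IsChamber n r ∧ Relation.ReflTransGen (L.ChamberAdj n) s r}
  let P' : Set (Finset ι) := {r | L.IsChamber n r ∧ ¬ Relation.ReflTransGen (L.ChamberAdj n) s r}
  have hsymm : ∀ {a b}, L.ChamberAdj n a b → L.ChamberAdj n b a := fun h =>
    ⟨h.2.1, h.1, by rw [Finset.inter_comm]; exact h.2.2⟩
  have hmem : ∀ p : L.Realization, p ∈ Set.univ \ L.polyhedron (L.skeleton ((n : ℤ) - 2)) ↔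
      n ≤ p.coord.support.card := by
    intro p
    have : p ∈ L.polyhedron (L.skeleton ((n : ℤ) - 2)) ↔
        p.coord.support ∈ L.faces ∧ (p.coord.support.card : ℤ) - 1 ≤ (n : ℤ) - 2 := Iff.rfl
    rw [Set.mem_sdiff, this]
    simp only [Set.mem_univ, p.support_mem, true_and]
    omega
  have hO : IsOpen (L.openPart n P) := isOpen_openPart hpure (fun r hr => hr.1)
    fun a ha b hab => ⟨hab.2.1, ha.2.tail hab⟩
  have hO' : IsOpen (L.openPart n P') := isOpen_openPart hpure (fun r hr => hr.1)
    fun a ha b hab => ⟨hab.2.1, fun h => ha.2 (h.tail (hsymm hab))⟩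
  have hpt : ∀ {r} {R : Set (Finset ι)}, L.IsChamber n r → r ∈ R →
      ((Set.univ \ L.polyhedron (L.skeleton ((n : ℤ) - 2))) ∩ L.openPart n R).Nonempty := by
    intro r R hr hrR
    obtain ⟨p, hp⟩ := L.exists_realization_support_eq hr.1
    have hc : n ≤ p.coord.support.card := by rw [hp, hr.2]; omega
    exact ⟨p, (hmem p).2 hc, hc, r, hrR, hp.le⟩
  obtain ⟨p, -, ⟨hc, a, ha, hpa⟩, -, b, hb, hpb⟩ := hconn.isPreconnected _ _ hO hO' (by
      intro p hp
      obtain ⟨r, hr, hpr, hcard⟩ := hpure _ p.support_mem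
      by_cases h : Relation.ReflTransGen (L.ChamberAdj n) s r
      · exact Or.inl ⟨(hmem p).1 hp, r, ⟨⟨hr, hcard⟩, h⟩, hpr⟩
      · exact Or.inr ⟨(hmem p).1 hp, r, ⟨⟨hr, hcard⟩, h⟩, hpr⟩)
    (hpt hs ⟨hs, .refl⟩) (hpt ht ⟨ht, hst⟩)
  exact hb.2 (ha.2.tail ⟨ha.1, hb.1,
    hc.trans (Finset.card_le_card (Finset.subset_inter hpa hpb))⟩)

variable [DecidableEq ι]

variable (L n) in
/-- An ordering of the vertices of an `n`-simplex of `L`. Its initial segments form a maximal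
flag of simplices. -/
def IsFlagList (l : List ι) : Prop :=
  l.Nodup ∧ l.length = n + 1 ∧ l.toFinset ∈ L.faces

variable (L n) in
/-- Two orderings of `n`-simplices whose flags differ in at most one place. -/
def FlagAdj (l l' : List ι) : Prop :=
  L.IsFlagList n l ∧ L.IsFlagList n l' ∧ ∃ m, 1 ≤ m ∧ m ≤ n + 1 ∧
    ∀ k ≤ n + 1, k ≠ m → (l.take k).toFinset = (l'.take k).toFinset

theorem IsFlagList.perm {l l' : List ι} (h : L.IsFlagList n l) (hp : l.Perm l') :
    L.IsFlagList n l' :=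
  ⟨hp.nodup_iff.1 h.1, hp.length_eq ▸ h.2.1, List.toFinset_eq_of_perm _ _ hp ▸ h.2.2⟩

/-- A permutation is a product of swaps of neighbours. The prefix `p` is arbitrary so that the
`cons` case can move the common head into it. -/
theorem reflTransGen_flagAdj_of_perm {l l' : List ι} (hp : l.Perm l') :
    ∀ p : List ι, L.IsFlagList n (p ++ l) →
      Relation.ReflTransGen (L.FlagAdj n) (p ++ l) (p ++ l') := by
  induction hp with
  | nil => exact fun p _ => .refl
  | cons a _ ih =>
    intro p h
    have := ih (p ++ [a]) (by simpa using h)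
    simpa using this
  | swap a b l =>
    intro p h
    -- Only the initial segment ending between the two swapped entries changes.
    refine .single ⟨h, h.perm ((List.Perm.swap a b l).append_left p), p.length + 1, by omega, ?_, ?_⟩
    · have := h.2.1
      simp at this
      omega
    · intro k _ hk
      rw [List.take_append, List.take_append]
      obtain h0 | h1 | ⟨j, hj⟩ : k - p.length = 0 ∨ k - p.length = 1 ∨ ∃ j, k - p.length = j + 2 := by
        rcases k - p.length with _ | _ | j
        · simp
        · simp
        · exact Or.inr (Or.inr ⟨j, rfl⟩)
      · simp [h0]
      · omega
      · ext x
        simp only [hj, List.take_succ_cons, List.mem_toFinset, List.mem_append, List.mem_cons]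
        tauto
  | trans hp1 _ ih1 ih2 =>
    intro p h
    exact (ih1 p h).trans (ih2 p (h.perm (hp1.append_left p)))

theorem reflTransGen_flagAdj_of_toFinset_eq {l l' : List ι} (hl : L.IsFlagList n l)
    (hl' : L.IsFlagList n l') (h : l.toFinset = l'.toFinset) :
    Relation.ReflTransGen (L.FlagAdj n) l l' :=
  reflTransGen_flagAdj_of_perm (List.perm_of_nodup_nodup_toFinset_eq hl.1 hl'.1 h) [] hl

theorem isFlagList_toList_append {f s : Finset ι} {a : ι} (ha : a ∉ f) (hs : insert a f = s)
    (hc : L.IsChamber n s) :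
    L.IsFlagList n (f.toList ++ [a]) ∧ (f.toList ++ [a]).toFinset = s := by
  have e : (f.toList ++ [a]).toFinset = s := by
    rw [← hs]
    ext x
    simp
  refine ⟨⟨?_, ?_, e ▸ hc.1⟩, e⟩
  · rw [List.nodup_append]
    refine ⟨f.nodup_toList, List.nodup_singleton a, ?_⟩
    intro x hx y hy
    rw [List.mem_singleton] at hy
    rintro rfl
    exact ha (hy ▸ Finset.mem_toList.1 hx)
  · have := hc.2
    rw [← hs, Finset.card_insert_of_notMem ha] at this
    simp
    omega

/-- When the chambers differ, reorder each so that the `n` common vertices come first, in the same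
order; then only the full segments, of length `n + 1`, differ. -/
theorem reflTransGen_flagAdj_of_chamberAdj {l l' : List ι} (hl : L.IsFlagList n l)
    (hl' : L.IsFlagList n l') (h : L.ChamberAdj n l.toFinset l'.toFinset) :
    Relation.ReflTransGen (L.FlagAdj n) l l' := by
  by_cases heq : l.toFinset = l'.toFinset
  · exact reflTransGen_flagAdj_of_toFinset_eq hl hl' heq
  obtain ⟨hs, ht, hcard⟩ := h
  have key : ∀ {s t : Finset ι}, L.IsChamber n s → L.IsChamber n t → s ≠ t → n ≤ (s ∩ t).card →
      ∃ a ∉ s ∩ t, insert a (s ∩ t) = s := by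
    intro s t hs ht hst hn
    have hlt : (s ∩ t).card < s.card := by
      refine Finset.card_lt_card (Finset.inter_subset_left.ssubset_of_ne fun h => hst ?_)
      exact Finset.eq_of_subset_of_card_le (Finset.inter_eq_left.1 h) (by rw [hs.2, ht.2])
    obtain ⟨a, has, ha⟩ := Finset.exists_mem_notMem_of_card_lt_card hlt
    refine ⟨a, ha, Finset.eq_of_subset_of_card_le
      (Finset.insert_subset has Finset.inter_subset_left) ?_⟩
    rw [Finset.card_insert_of_notMem ha, hs.2]
    omega
  obtain ⟨a, ha, has⟩ := key hs ht heq hcard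
  obtain ⟨b, hb, hbt⟩ := key ht hs (Ne.symm heq) (by rwa [Finset.inter_comm])
  rw [Finset.inter_comm] at hb hbt
  obtain ⟨h1, e1⟩ := isFlagList_toList_append ha has hs
  obtain ⟨h2, e2⟩ := isFlagList_toList_append hb hbt ht
  have hlen := h1.2.1
  rw [List.length_append, List.length_singleton] at hlen
  refine ((reflTransGen_flagAdj_of_toFinset_eq hl h1 e1.symm).tail
    ⟨h1, h2, n + 1, by omega, le_rfl, fun k hk hkn => ?_⟩).trans
    (reflTransGen_flagAdj_of_toFinset_eq h2 hl' e2)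
  rw [List.take_append_of_le_length (by omega), List.take_append_of_le_length (by omega)]

theorem IsChamber.isFlagList_toList {s : Finset ι} (h : L.IsChamber n s) :
    L.IsFlagList n s.toList :=
  ⟨s.nodup_toList, by simpa using h.2, by simpa using h.1⟩

theorem reflTransGen_flagAdj (hpure : L.EveryFaceInSimplex n)
    (hconn : IsConnected (Set.univ \ L.polyhedron (L.skeleton ((n : ℤ) - 2))))
    {l l' : List ι} (hl : L.IsFlagList n l) (hl' : L.IsFlagList n l') :
    Relation.ReflTransGen (L.FlagAdj n) l l' := by
  have hch : ∀ {l}, L.IsFlagList n l → L.IsChamber n l.toFinset := fun h =>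
    ⟨h.2.2, by rw [List.toFinset_card_of_nodup h.1, h.2.1]⟩
  have key : ∀ t, Relation.ReflTransGen (L.ChamberAdj n) l.toFinset t → ∀ l', L.IsFlagList n l' →
      l'.toFinset = t → Relation.ReflTransGen (L.FlagAdj n) l l' := by
    intro t ht
    induction ht with
    | refl => exact fun l' hl' h => reflTransGen_flagAdj_of_toFinset_eq hl hl' h.symm
    | @tail b c _ hbc ih =>
      intro l' hl' h
      have hb := hbc.1.isFlagList_toList
      refine (ih _ hb b.toList_toFinset).trans (reflTransGen_flagAdj_of_chamberAdj hb hl' ?_)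
      rwa [b.toList_toFinset, h]
  exact key _ (reflTransGen_chamberAdj hpure hconn (hch hl) (hch hl')) l' hl' rfl

theorem exists_isFlagList_take_eq (hpure : L.EveryFaceInSimplex n) {r : Finset ι}
    (hr : r ∈ L.faces) : ∃ l, L.IsFlagList n l ∧ ∃ k ≤ n + 1, (l.take k).toFinset = r := by
  obtain ⟨t, ht, hrt, hcard⟩ := hpure r hr
  have hp : (r.toList ++ (t \ r).toList).toFinset = t := by
    ext x
    simp only [List.mem_toFinset, List.mem_append, Finset.mem_toList, Finset.mem_sdiff]
    have := @hrt x
    tauto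
  have hc := Finset.card_sdiff_add_card_eq_card hrt
  refine ⟨r.toList ++ (t \ r).toList, ⟨?_, ?_, hp.symm ▸ ht⟩, r.card, ?_, ?_⟩
  · refine List.Nodup.append r.nodup_toList (t \ r).nodup_toList fun x hx hx' => ?_
    rw [Finset.mem_toList] at hx hx'
    exact (Finset.mem_sdiff.1 hx').2 hx
  · simp
    omega
  · omega
  · rw [List.take_append_of_le_length (by simp), List.take_of_length_le (by simp)]
    simp

end AbstractSimplicialComplex

/-! ### Flags as sets of generators -/

namespace CoxeterSystem

variable {ι : Type u} {V : Type v} {Γ : Type w} [Group Γ] {M : CoxeterMatrix V}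
  (cs : CoxeterSystem M Γ) {L : AbstractSimplicialComplex ι} {n : ℕ}

/-- The generators corresponding to the initial segments of a list of vertices. -/
def flagSet [DecidableEq ι] (n : ℕ) (e : V ≃ L.faces) (l : List ι) : Set V :=
  -- `k = 0` contributes nothing, since simplices are non-empty.
  {v | ∃ k ≤ n + 1, (l.take k).toFinset = (e v : Finset ι)}

/-- The colour of a generator: the dimension of the corresponding simplex. -/
def faceColour (hdim : L.HasDimension n) (e : V ≃ L.faces) (v : V) : Fin (n + 1) :=
  ⟨(e v : Finset ι).card - 1, by
    have := hdim.1 _ (e v).2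
    omega⟩

theorem faceColour_eq_iff (hdim : L.HasDimension n) (e : V ≃ L.faces) {v w : V} :
    faceColour hdim e v = faceColour hdim e w ↔
      (e v : Finset ι).card = (e w : Finset ι).card := by
  have h1 := (L.isRelLowerSet_faces (e v).2).1.card_pos
  have h2 := (L.isRelLowerSet_faces (e w).2).1.card_pos
  rw [Fin.ext_iff]
  simp only [faceColour]
  omega

theorem eq_two_iff_comparable (hM : M.IsRightAngled) (e : V ≃ L.faces)
    (he : ∀ s, s ∈ cs.complex.faces ↔ s.map e.toEmbedding ∈ L.barycentricSubdivision.faces)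
    {v w : V} (hvw : v ≠ w) :
    M v w = 2 ↔ (e v : Finset ι) ⊆ e w ∨ (e w : Finset ι) ⊆ e v := by
  classical
  rw [← cs.pair_mem_complex_iff hM hvw, he]
  have hne : e v ≠ e w := fun h => hvw (e.injective h)
  constructor
  · rintro ⟨-, h⟩
    exact h (by simp) (by simp) hne
  · refine fun h => ⟨by simp, ?_⟩
    intro a ha b hb hab
    simp at ha hb
    rcases ha with rfl | rfl <;> rcases hb with rfl | rfl
    · exact absurd rfl hab
    · exact h
    · exact h.symm
    · exact absurd rfl hab

theorem faceColour_ne (hM : M.IsRightAngled) (hdim : L.HasDimension n) (e : V ≃ L.faces)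
    (he : ∀ s, s ∈ cs.complex.faces ↔ s.map e.toEmbedding ∈ L.barycentricSubdivision.faces)
    (v w : V) (h : M v w = 2) : faceColour hdim e v ≠ faceColour hdim e w := by
  have hvw : v ≠ w := by
    rintro rfl
    simp at h
  intro hc
  rw [faceColour_eq_iff] at hc
  apply hvw
  apply e.injective
  rcases (cs.eq_two_iff_comparable hM e he hvw).1 h with h | h
  · exact Subtype.ext (Finset.eq_of_subset_of_card_le h hc.ge)
  · exact Subtype.ext (Finset.eq_of_subset_of_card_le h hc.le).symm

theorem commute_of_comparable (hM : M.IsRightAngled) (e : V ≃ L.faces)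
    (he : ∀ s, s ∈ cs.complex.faces ↔ s.map e.toEmbedding ∈ L.barycentricSubdivision.faces)
    {v w : V} (h : (e v : Finset ι) ⊆ e w ∨ (e w : Finset ι) ⊆ e v) :
    Commute (cs.simple v) (cs.simple w) := by
  by_cases hvw : v = w
  · exact hvw ▸ Commute.refl _
  · exact cs.commute_simple ((cs.eq_two_iff_comparable hM e he hvw).2 h)

variable [DecidableEq ι]

theorem toFinset_mono_of_subset {l l' : List ι} (h : l ⊆ l') : l.toFinset ⊆ l'.toFinset :=
  fun _ hx => List.mem_toFinset.2 (h (List.mem_toFinset.1 hx))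

theorem take_toFinset_comparable (l : List ι) (j k : ℕ) :
    (l.take j).toFinset ⊆ (l.take k).toFinset ∨ (l.take k).toFinset ⊆ (l.take j).toFinset := by
  have key : ∀ {a b}, a ≤ b → (l.take a).toFinset ⊆ (l.take b).toFinset := fun h =>
    toFinset_mono_of_subset (List.take_subset_take_left l h)
  exact (le_total j k).imp key key

theorem flagSet_comparable (e : V ≃ L.faces) {l : List ι} {v w : V}
    (hv : v ∈ flagSet n e l) (hw : w ∈ flagSet n e l) :
    (e v : Finset ι) ⊆ e w ∨ (e w : Finset ι) ⊆ e v := by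
  obtain ⟨j, -, hj⟩ := hv
  obtain ⟨k, -, hk⟩ := hw
  rw [← hj, ← hk]
  exact take_toFinset_comparable l j k

theorem finite_flagSet (e : V ≃ L.faces) (l : List ι) : (flagSet n e l).Finite := by
  refine Set.Finite.of_finite_image (f := fun v => (e v : Finset ι)) ?_
    (Subtype.val_injective.comp e.injective).injOn
  refine ((Set.finite_Iic (n + 1)).image fun k => (l.take k).toFinset).subset ?_
  rintro _ ⟨v, ⟨k, hk, hkv⟩, rfl⟩
  exact ⟨k, hk, hkv⟩

theorem exists_mem_flagSet_card_eq (e : V ≃ L.faces) {l : List ι} (hl : L.IsFlagList n l) {k : ℕ}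
    (h1 : 1 ≤ k) (hk : k ≤ n + 1) :
    ∃ v ∈ flagSet n e l, (e v : Finset ι) = (l.take k).toFinset ∧ (e v : Finset ι).card = k := by
  have hlen : (l.take k).length = k := by
    rw [List.length_take, hl.2.1]
    omega
  have hcard : (l.take k).toFinset.card = k := by
    rw [List.toFinset_card_of_nodup (hl.1.sublist (List.take_sublist k l)), hlen]
  have hmem : (l.take k).toFinset ∈ L.faces :=
    (L.isRelLowerSet_faces hl.2.2).2
      (toFinset_mono_of_subset (List.take_subset k l))
      (Finset.card_pos.1 (by omega))
  exact ⟨e.symm ⟨_, hmem⟩, ⟨k, hk, by simp⟩, by simp, by simpa using hcard⟩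

theorem finite_closure_flagSet (e : V ≃ L.faces)
    (he : ∀ s, s ∈ cs.complex.faces ↔ s.map e.toEmbedding ∈ L.barycentricSubdivision.faces)
    {l : List ι} (hl : L.IsFlagList n l) :
    Finite (Subgroup.closure (cs.simple '' flagSet n e l)) := by
  obtain ⟨v, hv, -⟩ := exists_mem_flagSet_card_eq e hl le_rfl (by omega)
  have hs : (finite_flagSet (n := n) e l).toFinset ∈ cs.complex.faces := by
    refine (he _).2 ⟨⟨e v, by simpa using hv⟩, ?_⟩
    intro a ha b hb _
    simp only [Finset.coe_map, Set.Finite.coe_toFinset] at ha hb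
    obtain ⟨a, ha, rfl⟩ := ha
    obtain ⟨b, hb, rfl⟩ := hb
    exact flagSet_comparable e ha hb
  simpa using hs.2

theorem map_colourSign_closure_flagSet (hM : M.IsRightAngled) (hdim : L.HasDimension n)
    (e : V ≃ L.faces) {l : List ι} (hl : L.IsFlagList n l) :
    (Subgroup.closure (cs.simple '' flagSet n e l)).map (cs.colourSign hM (faceColour hdim e)) =
      ⊤ := by
  refine Subgroup.eq_top_of_mulSingle_neg_one_mem _ fun i => ?_
  obtain ⟨v, hv, -, hcard⟩ := exists_mem_flagSet_card_eq e hl (k := i + 1) (by omega) (by omega)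
  refine ⟨cs.simple v, Subgroup.subset_closure ⟨v, hv, rfl⟩, ?_⟩
  rw [colourSign_simple]
  congr 1
  rw [Fin.ext_iff]
  simp only [faceColour]
  omega

/-- Each flag move is an exchange: the old and new simplices have `m` vertices, hence the same
colour, and the new one is comparable to the remaining simplices of the old flag because they also
belong to the new flag. -/
theorem exists_mem_galleryLevel (hM : M.IsRightAngled) (hdim : L.HasDimension n)
    (hpure : L.EveryFaceInSimplex n)
    (hconn : IsConnected (Set.univ \ L.polyhedron (L.skeleton ((n : ℤ) - 2))))
    (e : V ≃ L.faces)
    (he : ∀ s, s ∈ cs.complex.faces ↔ s.map e.toEmbedding ∈ L.barycentricSubdivision.faces)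
    {l₀ : List ι} (hl₀ : L.IsFlagList n l₀) (v : V) :
    ∃ k, v ∈ Subgroup.galleryLevel cs.simple (cs.colourSign hM (faceColour hdim e))
      (flagSet n e '' {l | L.IsFlagList n l}) (flagSet n e l₀) k := by
  obtain ⟨l, hl, j, hj, hjv⟩ := L.exists_isFlagList_take_eq hpure (e v).2
  suffices ∀ l, Relation.ReflTransGen (L.FlagAdj n) l₀ l → ∃ k, flagSet n e l ⊆
      Subgroup.galleryLevel cs.simple (cs.colourSign hM (faceColour hdim e))
        (flagSet n e '' {l | L.IsFlagList n l}) (flagSet n e l₀) k by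
    obtain ⟨k, hk⟩ := this l (L.reflTransGen_flagAdj hpure hconn hl₀ hl)
    exact ⟨k, hk ⟨j, hj, hjv⟩⟩
  intro l hll
  induction hll with
  | refl => exact ⟨0, subset_rfl⟩
  | @tail l l' _ hadj ih =>
    obtain ⟨k, hk⟩ := ih
    obtain ⟨hl, hl', m, hm1, hm, hagree⟩ := hadj
    refine ⟨k + 1, fun w hw => ?_⟩
    obtain ⟨i, hi, hiw⟩ := hw
    by_cases him : i = m
    · subst him
      obtain ⟨x, hx, hxe, hxc⟩ := exists_mem_flagSet_card_eq e hl hm1 hm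
      obtain ⟨w', -, hwe, hwc⟩ := exists_mem_flagSet_card_eq e hl' hm1 hm
      have hww : w' = w := e.injective (Subtype.ext (hwe.trans hiw))
      subst hww
      refine Or.inr ⟨_, ⟨l, hl, rfl⟩, hk, x, hx, ?_, ?_⟩
      · rw [colourSign_simple, colourSign_simple,
          (faceColour_eq_iff hdim e).2 (hxc.trans hwc.symm)]
      · intro y hy hyx
        obtain ⟨j, hj, hjy⟩ := hy
        have hji : j ≠ i := by
          rintro rfl
          exact hyx (e.injective (Subtype.ext (hjy.symm.trans hxe.symm)))
        refine cs.commute_of_comparable hM e he ?_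
        rw [← hjy, hwe, hagree j hj hji]
        exact take_toFinset_comparable l' i j
    · exact Or.inl (hk ⟨i, hi, (hagree i hi him).trans hiw⟩)

end CoxeterSystem

/-! ### The main theorem -/

open CoxeterSystem in
theorem corollary12 {ι : Type u} {V : Type v} {Γ : Type w} [Group Γ]
    {M : CoxeterMatrix V} (cs : CoxeterSystem M Γ) (hM : M.IsRightAngled)
    (L : AbstractSimplicialComplex ι) (n : ℕ)
    (hdim : L.HasDimension n)
    (hpure : L.EveryFaceInSimplex n)
    (hconn : IsConnected (Set.univ \ L.polyhedron (L.skeleton ((n : ℤ) - 2))))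
    (hK : cs.complex.IsIsomorphic L.barycentricSubdivision) :
    (∃ Γ₁ : Subgroup Γ, Γ₁.Normal ∧ Γ₁.HasNoTorsion ∧ Γ₁.index = 2 ^ (n + 1) ∧
      ∃ S : Set Γ, Subgroup.closure S = Γ₁ ∧
        Cardinal.lift.{u} (Cardinal.mk S) + (n + 1) = Cardinal.lift.{w} (Cardinal.mk L.faces)) ∧
    (∀ H : Subgroup Γ, H.HasNoTorsion → H.index ≠ 0 → 2 ^ (n + 1) ≤ H.index) ∧
    (∀ H : Subgroup Γ, H.Normal → H.index = 2 ^ (n + 1) →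
      ∀ S : Set Γ, Subgroup.closure S = H →
        Cardinal.lift.{w} (Cardinal.mk L.faces) ≤
          Cardinal.lift.{u} (Cardinal.mk S) + (n + 1)) := by
  classical
  obtain ⟨e, he⟩ := hK
  obtain ⟨s₀, hs₀, hcard₀⟩ := hdim.2
  obtain ⟨l₀, hl₀⟩ : ∃ l₀, L.IsFlagList n l₀ :=
    ⟨_, AbstractSimplicialComplex.IsChamber.isFlagList_toList ⟨hs₀, hcard₀⟩⟩
  have hcol := cs.faceColour_ne hM hdim e he
  have hmap := cs.map_colourSign_closure_flagSet hM hdim e hl₀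
  have hfin := cs.finite_closure_flagSet e he hl₀
  have htf := cs.ker_colourSign_hasNoTorsion hM _ hcol
  set φ := cs.colourSign hM (faceColour hdim e) with hφ
  have hcardQ : Nat.card (Fin (n + 1) → ℤˣ) = 2 ^ (n + 1) := by simp
  have hindex : φ.ker.index = 2 ^ (n + 1) := by
    have hr : φ.range = ⊤ := by
      rw [eq_top_iff, ← hmap, MonoidHom.range_eq_map]
      exact Subgroup.map_mono le_top
    rw [Subgroup.index_ker, hr, Subgroup.card_top, hcardQ]
  have hlower : ∀ H : Subgroup Γ, H.index = 2 ^ (n + 1) → ∀ S : Set Γ, Subgroup.closure S = H →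
      Cardinal.lift.{w} (Cardinal.mk L.faces) ≤ Cardinal.lift.{u} (Cardinal.mk S) + (n + 1) := by
    intro H hH S hS
    have := cs.lift_mk_le_add_of_index_le hM e (by rw [hH]; positivity) hH.le hS
    exact_mod_cast this
  refine ⟨⟨φ.ker, inferInstance, htf, hindex, ?_⟩, ?_, fun H _ => hlower H⟩
  · obtain ⟨g, hg⟩ := Subgroup.exists_closure_image_compl_eq_ker cs.simple φ
      (flagSet n e '' {l | L.IsFlagList n l}) (flagSet n e l₀) cs.simple_mul_simple_self
      cs.subgroup_closure_range_simple
      (by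
        rintro _ ⟨l, -, rfl⟩ x hx y hy
        exact cs.commute_of_comparable hM e he (flagSet_comparable e hx hy))
      (by
        rintro _ ⟨l, hl, rfl⟩
        exact cs.map_colourSign_closure_flagSet hM hdim e hl)
      (by
        rw [Subgroup.eq_bot_iff_forall]
        intro x hx
        obtain ⟨hx, hxk⟩ := Subgroup.mem_inf.1 hx
        exact htf x hxk ((Subgroup.subtype _).isOfFinOrder (isOfFinOrder_of_finite
          (⟨x, hx⟩ : Subgroup.closure (cs.simple '' flagSet n e l₀)))))
      (cs.exists_mem_galleryLevel hM hdim hpure hconn e he hl₀)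
    -- Only the upper bound is left: the lower bound for arbitrary generating sets supplies the
    -- other half of the equality.
    refine ⟨_, hg, le_antisymm ?_ (hlower _ hindex _ hg)⟩
    -- Indexing by simplices instead of generators keeps the count free of the universe of `V`.
    have himg : g '' (flagSet n e l₀)ᶜ = (g ∘ e.symm) '' (e '' flagSet n e l₀)ᶜ := by
      rw [Set.image_comp, ← Set.image_compl_eq e.bijective, Equiv.symm_image_image]
    have h1 : Cardinal.lift.{u} (Cardinal.mk (g '' (flagSet n e l₀)ᶜ : Set Γ)) ≤
        Cardinal.lift.{w} (Cardinal.mk ((e '' flagSet n e l₀)ᶜ : Set L.faces)) := by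
      rw [himg]
      exact Cardinal.mk_image_le_lift
    have h2 : ((n + 1 : ℕ) : Cardinal.{u}) ≤ Cardinal.mk (e '' flagSet n e l₀ : Set L.faces) := by
      choose x hx _ hxc using fun i : Fin (n + 1) =>
        exists_mem_flagSet_card_eq e hl₀ (k := i + 1) (by omega) (by omega)
      have hinj : Function.Injective fun i => (⟨e (x i), x i, hx i, rfl⟩ :
          (e '' flagSet n e l₀ : Set L.faces)) := by
        intro i j hij
        have : e (x i) = e (x j) := congrArg Subtype.val hij
        have h3 := hxc i
        rw [this, hxc j] at h3
        exact Fin.ext (by omega)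
      have := Cardinal.mk_le_of_injective (hinj.comp ULift.down_injective.{0, u})
      rwa [Cardinal.mk_uLift, Cardinal.mk_fin, Cardinal.lift_natCast] at this
    calc Cardinal.lift.{u} (Cardinal.mk (g '' (flagSet n e l₀)ᶜ : Set Γ)) + (n + 1)
        = Cardinal.lift.{u} (Cardinal.mk (g '' (flagSet n e l₀)ᶜ : Set Γ)) +
            Cardinal.lift.{w} ((n + 1 : ℕ) : Cardinal.{u}) := by simp
      _ ≤ Cardinal.lift.{w} (Cardinal.mk ((e '' flagSet n e l₀)ᶜ : Set L.faces)) +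
            Cardinal.lift.{w} (Cardinal.mk (e '' flagSet n e l₀ : Set L.faces)) :=
          add_le_add h1 (Cardinal.lift_le.2 h2)
      _ = Cardinal.lift.{w} (Cardinal.mk L.faces) := by
          rw [← Cardinal.lift_add, add_comm, Cardinal.mk_sum_compl]
  · intro H hH h0
    refine le_trans ?_ (hH.card_le_index h0 (Subgroup.closure (cs.simple '' flagSet n e l₀)))
    -- The finite flag subgroup has the whole of `(ℤ/2)^(n+1)` as a quotient.
    rw [← hcardQ, ← Subgroup.card_top, ← hmap]
    exact Nat.le_of_dvd Nat.card_pos (Subgroup.card_map_dvd _ _)
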